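/- Let $K,N,M\ge 1$ be integers and let $\mathcal D=\{f^{(1)},\dots,f^{(m)}\}\subset\mathbb R^N$ be a dictionary of unit-norm vectors with prior probabilities $p^{(1)},\dots,p^{(m)}>0$, $\sum_j p^{(j)}=1$. Let $\alpha_1,\dots,\alpha_M\ge 0$, $\sigma>0$, and let $\Sigma_b$ be a positive semidefinite $N\times N$ covariance matrix with largest eigenvalue $\lambda_{\max}$. Put $$p_{\min}=\min_j p^{(j)},\quad p_{\max}=\max_j p^{(j)},\quad \alpha_{\min}=\min_i\alpha_i,\quad d_{\min}=\min_{i\ne j}\|f^{(i)}-f^{(j)}\|.$$ For a matrix $A\in\mathbb R^{K\times N}$ consider the observations $y_i=\alpha_iAf_i^*+n_i$, $i=1,\dots,M$, where the $f_i^*$ are i.i.d. with $\mathbb P(f_i^*=f^{(j)})=p^{(j)}$, the $n_i$ are i.i.d. $\mathcal N(0,I_K)$, and all these variables are mutually independent. For each $j$, the null hypothesis $f_i^*=f^{(j)}$ at location $i$ is rejected when $y_i\in\Gamma_i^{(j)}$, where $$\Gamma^{(j)}_i=\Big\{y:\ -\tfrac12\|y-\alpha_iAf^{(j)}\|^2+\log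 p^{(j)}\le-\tfrac12\|y-\alpha_iAf^{(\ell)}\|^2+\log p^{(\ell)}\ \text{for some }\ell\neq j\Big\}.$$ Let $R_j$ be the number of $i$ with $y_i\in\Gamma_i^{(j)}$, and $V_j$ the number of those $i$ for which moreover $f_i^*=f^{(j)}$. Put $\mathrm{pFDR}^{(j)}=\mathbb E[V_j/R_j\mid R_j>0]$ and $\mathrm{pFDR}_{\max}(A)=\max_j\mathrm{pFDR}^{(j)}$. Fix $0<\epsilon<1-p_{\max}$ and suppose that $$1-p_{\max}-\epsilon\ \ge\ \frac{1-p_{\min}}{p_{\min}}\Big(1+\frac{\alpha_{\min}^2d_{\min}^2}{4K\sigma^2}\Big)^{-K/2}+2\exp\Big(-\frac{(K+N)\epsilon^2}{2}\Big),$$ $$\lambda_{\max}<\frac{1}{(1+\epsilon)^2\big(\sqrt{N/K}+1\big)^2},\qquad K>\frac{2\log\Big(\frac{2}{p_{\min}}\,\frac{1-p_{\min}}{1-p_{\max}}\Big)}{\log\Big(1+\frac{\alpha_{\min}^2d_{\min}^2}{4K}\Big)}.$$ Then there exists a $K\times N$ sensing matrix $A$, that is, a matrix of the form $A=(\Phi\Sigma_b\Phi^T+\sigma^2I)^{-1/2}\Phi$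 with $\Phi\in\mathbb R^{K\times N}$, such that $\lambda_{\max}<1/\|A\|^2$ (spectral norm), $\mathbb P(R_j>0)>0$ for every $j$, and $$\mathrm{pFDR}_{\max}(A)\le\frac1{p_{\min}}\Big(\frac{1-p_{\max}}{1-p_{\min}}\Big(1+\frac{\alpha_{\min}^2d_{\min}^2}{4K}\Big)^{K/2}-\frac1{p_{\min}}\Big)^{-1}+\frac{2(1-p_{\max})}{\epsilon^2}\exp\Big(-\frac{(K+N)\epsilon^2}{2}\Big).$$ -/

import Mathlib

open MeasureTheory ProbabilityTheory

noncomputable section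

namespace DSD

/-- The spectral norm of a real `K × N` matrix: its operator norm between Euclidean spaces. -/
def spectralNorm {K N : ℕ} (A : Matrix (Fin K) (Fin N) ℝ) : ℝ :=
  ‖LinearMap.toContinuousLinearMap (Matrix.toEuclideanLin A)‖

/-- The largest eigenvalue of a real symmetric matrix. -/
def largestEigenvalue {N : ℕ} {S : Matrix (Fin N) (Fin N) ℝ} (hS : S.IsHermitian) : ℝ :=
  ⨆ i : Fin N, hS.eigenvalues i

/-- `C` is the inverse square root `S ^ (-1/2)` of `S`:
the (unique) positive definite matrix whose square is the inverse of `S`. -/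
def IsInvSqrt {K : ℕ} (S C : Matrix (Fin K) (Fin K) ℝ) : Prop :=
  C.PosDef ∧ C * C * S = 1

/-- `A` arises by whitening the measurements taken with some matrix `Φ`, i.e. `A = C * Φ`, where
`C = (Φ Σ Φᵀ + σ² I) ^ (-1/2)` is the whitening filter of the total noise `Φ b + w`,
`b ∼ N(0, Σ)`, `w ∼ N(0, σ² I)`. -/
def IsWhitenedSensing {K N : ℕ} (Sb : Matrix (Fin N) (Fin N) ℝ) (σ : ℝ)
    (A : Matrix (Fin K) (Fin N) ℝ) : Prop :=
  ∃ (Φ : Matrix (Fin K) (Fin N) ℝ) (C : Matrix (Fin K) (Fin K) ℝ),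
    IsInvSqrt (Φ * Sb * Φ.transpose + σ ^ 2 • (1 : Matrix (Fin K) (Fin K) ℝ)) C ∧ A = C * Φ

/-- Smallest distance between two different dictionary elements. -/
def dMin {m N : ℕ} (f : Fin m → EuclideanSpace ℝ (Fin N)) : ℝ :=
  ⨅ q : {q : Fin m × Fin m // q.1 ≠ q.2}, ‖f q.1.1 - f q.1.2‖

/-- The law of the class label of a target: class `j` has probability `p j`. -/
def prior {m : ℕ} (p : Fin m → ℝ) : Measure (Fin m) :=
  ∑ j, ENNReal.ofReal (p j) • Measure.dirac j

/-- The joint law of the class labels and noise vectors at the `M` locations: the labels are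
i.i.d. with law `prior p`, the noises are i.i.d. standard Gaussian in `ℝ ^ K`, and all of them
are mutually independent. -/
def modelLaw {m : ℕ} (M K : ℕ) (p : Fin m → ℝ) :
    Measure (Fin M → Fin m × EuclideanSpace ℝ (Fin K)) :=
  Measure.pi fun _ => (prior p).prod (stdGaussian (EuclideanSpace ℝ (Fin K)))

variable {m M K N : ℕ}

/-- The target `f*` at location `i`. -/
def target (f : Fin m → EuclideanSpace ℝ (Fin N)) (i : Fin M)
    (ω : Fin M → Fin m × EuclideanSpace ℝ (Fin K)) : EuclideanSpace ℝ (Fin N) :=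
  f (ω i).1

/-- The whitened observation `y = α A f* + n` at location `i`. -/
def obs (f : Fin m → EuclideanSpace ℝ (Fin N)) (α : Fin M → ℝ) (A : Matrix (Fin K) (Fin N) ℝ)
    (i : Fin M) (ω : Fin M → Fin m × EuclideanSpace ℝ (Fin K)) : EuclideanSpace ℝ (Fin K) :=
  α i • Matrix.toEuclideanLin A (target f i ω) + (ω i).2

/-- The (unnormalised) log posterior of class `j` given the observation `y`, at signal-to-noise
ratio `a`. -/
def logPosterior (f : Fin m → EuclideanSpace ℝ (Fin N)) (p : Fin m → ℝ) (a : ℝ)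
    (A : Matrix (Fin K) (Fin N) ℝ) (j : Fin m) (y : EuclideanSpace ℝ (Fin K)) : ℝ :=
  (K : ℝ) / 2 * Real.log (1 / (2 * Real.pi))
    - ‖y - a • Matrix.toEuclideanLin A (f j)‖ ^ 2 / 2 + Real.log (p j)

/-- The significance region for the null hypothesis "the target is `f j`" at signal-to-noise
ratio `a`. -/
def sigRegion (f : Fin m → EuclideanSpace ℝ (Fin N)) (p : Fin m → ℝ) (a : ℝ)
    (A : Matrix (Fin K) (Fin N) ℝ) (j : Fin m) : Set (EuclideanSpace ℝ (Fin K)) :=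
  {y | ∃ l, l ≠ j ∧ logPosterior f p a A j y ≤ logPosterior f p a A l y}

open Classical in
/-- The number of rejected null hypotheses. -/
def numRejected (f : Fin m → EuclideanSpace ℝ (Fin N)) (p : Fin m → ℝ) (α : Fin M → ℝ)
    (A : Matrix (Fin K) (Fin N) ℝ) (j : Fin m)
    (ω : Fin M → Fin m × EuclideanSpace ℝ (Fin K)) : ℝ :=
  ∑ i : Fin M, if obs f α A i ω ∈ sigRegion f p (α i) A j then 1 else 0

open Classical in
/-- The number of falsely rejected null hypotheses. -/
def numFalselyRejected (f : Fin m → EuclideanSpace ℝ (Fin N)) (p : Fin m → ℝ) (α : Fin M → ℝ)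
    (A : Matrix (Fin K) (Fin N) ℝ) (j : Fin m)
    (ω : Fin M → Fin m × EuclideanSpace ℝ (Fin K)) : ℝ :=
  ∑ i : Fin M, (if obs f α A i ω ∈ sigRegion f p (α i) A j then 1 else 0) *
    (if target f i ω = f j then 1 else 0)

/-- The event that at least one null hypothesis is rejected. -/
def someRejected (f : Fin m → EuclideanSpace ℝ (Fin N)) (p : Fin m → ℝ) (α : Fin M → ℝ)
    (A : Matrix (Fin K) (Fin N) ℝ) (j : Fin m) :
    Set (Fin M → Fin m × EuclideanSpace ℝ (Fin K)) :=
  {ω | 0 < numRejected f p α A j ω}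

/-- The positive false discovery rate `E[V / R | R > 0]` for the target `f j`. -/
def pFDR (f : Fin m → EuclideanSpace ℝ (Fin N)) (p : Fin m → ℝ) (α : Fin M → ℝ)
    (A : Matrix (Fin K) (Fin N) ℝ) (j : Fin m) : ℝ :=
  ∫ ω, numFalselyRejected f p α A j ω / numRejected f p α A j ω
    ∂(ProbabilityTheory.cond (modelLaw M K p) (someRejected f p α A j))

/-- The worst-case positive false discovery rate over all targets of the dictionary. -/
def pFDRMax (f : Fin m → EuclideanSpace ℝ (Fin N)) (p : Fin m → ℝ) (α : Fin M → ℝ)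
    (A : Matrix (Fin K) (Fin N) ℝ) : ℝ :=
  ⨆ j : Fin m, pFDR f p α A j

end DSD

end

/-! Two estimates are combined. For detection, the event that class `j` loses to class `l` under
truth `j` has joint probability at most `√(p j * p l) * exp (-(a ^ 2 / 8) * ‖A (f j - f l)‖ ^ 2)`
(`mul_stdGaussian_real_le`). By Cauchy–Schwarz the weights `√(p j * p l)`, `j ≠ l`, add up to at
most `(1 - pmin) / pmin` (`sum_offDiag_sqrt_mul_le`). By independence of the locations, pFDR is at
most the largest conditional probability, over locations, that a rejected hypothesis is true
(`integral_sum_div_sum_le`); this is at most `b / (1 - p j)` when `b < 1 - p j` bounds the confusion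
probability.

For the choice of `A`, an i.i.d. Gaussian matrix would require concentration of its norm. Instead,
for `K ≤ N`, take `√(N / K)` times a coordinate projection after a Haar-random rotation, and for `N
≤ K` the isometric padding by zeros. The norm bound `√(N / K) + 1` is then deterministic, and on
average the exponentials are no larger than for the Gaussian matrix (`exists_linearMap_sum_exp_le`),
so some rotation is good for all pairs at once. This gives `b = (1 - pmin) / pmin * (1 + αmin² dmin²
/ (4K)) ^ (-K/2)`.

The norm bound and the condition on `lamMax` make `1 - A Σ Aᵀ` positive definite, which suffices for
`A` to be a whitened matrix (`isWhitenedSensing_of_posDef`). The exponential term in the final bound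
is nonnegative slack. -/

namespace DSD

/-! ### Gaussian Laplace transforms -/

/-- Laplace transform of the square of a standard Gaussian variable. -/
lemma integral_exp_neg_mul_sq_gaussianReal {c : ℝ} (hc : 0 ≤ c) :
    ∫ x, Real.exp (-(c * x ^ 2)) ∂(gaussianReal 0 1) = (1 + 2 * c) ^ (-(1 : ℝ) / 2) := by
  rw [integral_gaussianReal_eq_integral_smul (by norm_num)]
  have h : ∀ x : ℝ, gaussianPDFReal 0 1 x • Real.exp (-(c * x ^ 2))
      = (√(2 * Real.pi))⁻¹ * Real.exp (-(c + 1 / 2) * x ^ 2) := by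
    intro x
    simp only [gaussianPDFReal, smul_eq_mul, NNReal.coe_one, mul_one, sub_zero]
    rw [mul_assoc, ← Real.exp_add]
    congr 2
    ring
  simp_rw [h]
  rw [integral_const_mul, integral_gaussian, ← Real.sqrt_inv, ← Real.sqrt_mul (by positivity),
    show (-(1 : ℝ) / 2) = -(1 / 2) by ring, Real.rpow_neg (by positivity), ← Real.sqrt_eq_rpow,
    ← Real.sqrt_inv]
  congr 1
  have := Real.pi_pos
  field_simp
  ring

lemma integral_exp_neg_sum_sq_stdGaussian {ι : Type*} [Fintype ι] {c : ι → ℝ}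
    (hc : ∀ i, 0 ≤ c i) :
    ∫ g, Real.exp (-∑ i, c i * g i ^ 2) ∂(stdGaussian (EuclideanSpace ℝ ι))
      = ∏ i, (1 + 2 * c i) ^ (-(1 : ℝ) / 2) := by
  rw [← map_pi_eq_stdGaussian, integral_map (by fun_prop)
    (Continuous.aestronglyMeasurable (by fun_prop))]
  simp_rw [← Finset.sum_neg_distrib, Real.exp_sum]
  rw [integral_fintype_prod_eq_prod (f := fun i x => Real.exp (-(c i * x ^ 2)))]
  exact Finset.prod_congr rfl fun i _ => integral_exp_neg_mul_sq_gaussianReal (hc i)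

lemma integral_exp_inner_stdGaussian {E : Type*} [NormedAddCommGroup E] [InnerProductSpace ℝ E]
    [FiniteDimensional ℝ E] [MeasurableSpace E] [BorelSpace E] (v : E) :
    Integrable (fun n => Real.exp (inner ℝ v n)) (stdGaussian E) ∧
    ∫ n, Real.exp (inner ℝ v n) ∂(stdGaussian E) = Real.exp (‖v‖ ^ 2 / 2) := by
  have hmap : (stdGaussian E).map (innerSL ℝ v) = gaussianReal 0 (‖v‖₊ ^ 2) := by
    have h := IsGaussian.map_eq_gaussianReal (μ := stdGaussian E) (innerSL ℝ v)
    rw [h, integral_strongDual_stdGaussian, variance_dual_stdGaussian, innerSL_apply_norm]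
    congr 1
    ext
    simp
  have h := mgf_gaussianReal hmap 1
  have hi := integrable_exp_mul_gaussianReal (μ := 0) (v := ‖v‖₊ ^ 2) 1
  rw [← hmap, integrable_map_measure (by fun_prop) (by fun_prop)] at hi
  constructor
  · simpa [Function.comp_def, innerSL_apply_apply] using hi
  · simpa [mgf, innerSL_apply_apply] using h

/-- Jensen's inequality for `𝔼 ‖g‖² = dim E`, obtained here from the product formula and `log (1 +
2a) ≤ 2a`. It allows a fixed length to be replaced by a Gaussian one. -/
lemma exp_neg_le_integral_exp_neg_norm_sq_stdGaussian {E : Type*} [NormedAddCommGroup E]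
    [InnerProductSpace ℝ E] [FiniteDimensional ℝ E] [MeasurableSpace E] [BorelSpace E]
    {a : ℝ} (ha : 0 ≤ a) :
    Real.exp (-(Module.finrank ℝ E * a)) ≤ ∫ g, Real.exp (-(a * ‖g‖ ^ 2)) ∂(stdGaussian E) := by
  have h := integral_exp_neg_sum_sq_stdGaussian (ι := Fin (Module.finrank ℝ E))
    (c := fun _ => a) fun _ => ha
  rw [← stdGaussian_map (stdOrthonormalBasis ℝ E).repr, integral_map (by fun_prop)
    (Continuous.aestronglyMeasurable (by fun_prop))] at h
  simp_rw [← Finset.mul_sum, ← EuclideanSpace.real_norm_sq_eq, LinearIsometryEquiv.norm_map] at h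
  rw [h, Finset.prod_const, Finset.card_univ, Fintype.card_fin, ← mul_neg, Real.exp_nat_mul]
  refine pow_le_pow_left₀ (Real.exp_pos _).le ?_ _
  rw [Real.rpow_def_of_pos (by positivity)]
  refine Real.exp_le_exp.mpr ?_
  have := Real.log_le_sub_one_of_pos (x := 1 + 2 * a) (by positivity)
  linarith

/-! ### Haar-random rotations compared with Gaussian vectors -/

instance compactSpace_unitary {E : Type*} [NormedAddCommGroup E] [InnerProductSpace ℝ E]
    [FiniteDimensional ℝ E] : CompactSpace (unitary (E →L[ℝ] E)) := by
  have := FiniteDimensional.proper ℝ (E →L[ℝ] E)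
  refine isCompact_iff_compactSpace.mp (IsCompact.of_isClosed_subset
    (isCompact_closedBall (0 : E →L[ℝ] E) 1) isClosed_unitary fun U hU => ?_)
  rw [mem_closedBall_zero_iff]
  refine ContinuousLinearMap.opNorm_le_bound _ zero_le_one fun x => ?_
  rw [ContinuousLinearMap.norm_map_of_mem_unitary hU, one_mul]

/-- Rotating a fixed unit vector by a Haar-random isometry and rescaling it to length `√(dim E)` makes
the Laplace transform of a nonnegative 2-homogeneous function at most the Gaussian one. -/
lemma integral_haar_exp_le_integral_stdGaussian {E : Type*} [NormedAddCommGroup E] [InnerProductSpace ℝ E]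
    [FiniteDimensional ℝ E] [MeasurableSpace E] [BorelSpace E]
    [MeasurableSpace (unitary (E →L[ℝ] E))]
    [BorelSpace (unitary (E →L[ℝ] E))]
    (μ : Measure (unitary (E →L[ℝ] E)))
    [IsProbabilityMeasure μ] [μ.IsMulLeftInvariant]
    {q : E → ℝ} (hq : Continuous q) (hq0 : ∀ x, 0 ≤ q x)
    (hqs : ∀ (c : ℝ) x, q (c • x) = c ^ 2 * q x)
    {e : E} (he : ‖e‖ = 1) {t : ℝ} (ht : 0 ≤ t) :
    ∫ U, Real.exp (-(Module.finrank ℝ E * t * q (U⁻¹.1 e))) ∂μ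
      ≤ ∫ g, Real.exp (-(t * q g)) ∂(stdGaussian E) := by
  have hinv : Continuous fun U : unitary (E →L[ℝ] E) => (U⁻¹).1 :=
    continuous_subtype_val.comp continuous_inv
  have hinv' : Continuous fun z : unitary (E →L[ℝ] E) × E => (z.1⁻¹).1 z.2 :=
    (hinv.comp continuous_fst).clm_apply continuous_snd
  have hinve : Continuous fun U : unitary (E →L[ℝ] E) => (U⁻¹).1 e :=
    hinv.clm_apply continuous_const
  have hint : ∀ {φ : unitary (E →L[ℝ] E) × E → ℝ}, Continuous φ → (∀ z, 0 ≤ φ z) →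
      Integrable (fun z => Real.exp (-(φ z))) (μ.prod (stdGaussian E)) := fun hφ h0 =>
    Integrable.of_bound (C := 1) (Continuous.aestronglyMeasurable (by fun_prop))
      (.of_forall fun z => by simpa [abs_of_pos, Real.exp_pos] using h0 z)
  have h1 : ∀ U : unitary (E →L[ℝ] E),
      ∫ g, Real.exp (-(t * q (U⁻¹.1 g))) ∂(stdGaussian E) = ∫ g, Real.exp (-(t * q g)) ∂(stdGaussian E) := by
    intro U
    have h := stdGaussian_map (Unitary.linearIsometryEquiv U⁻¹)
    nth_rewrite 2 [show stdGaussian E = Measure.map (Unitary.linearIsometryEquiv U⁻¹) (stdGaussian E) from h.symm]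
    rw [integral_map (by fun_prop) (Continuous.aestronglyMeasurable (by fun_prop))]
    rfl
  have h2 : ∀ g : E, ∫ U, Real.exp (-(t * q (U⁻¹.1 g))) ∂μ
      = ∫ U, Real.exp (-(t * (‖g‖ ^ 2 * q (U⁻¹.1 e)))) ∂μ := by
    intro g
    -- The reflection exchanging two vectors of equal length; left-translating the Haar integral by
    -- it replaces `U⁻¹ g` by `‖g‖ • U⁻¹ e`.
    obtain ⟨V, hV⟩ : ∃ V : E ≃ₗᵢ[ℝ] E, V (‖g‖ • e) = g :=
      ⟨_, Submodule.reflection_sub (by simp [norm_smul, he])⟩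
    set W : unitary (E →L[ℝ] E) := Unitary.linearIsometryEquiv.symm V
    have hW : W.1 (‖g‖ • e) = g := hV
    rw [← integral_mul_left_eq_self (μ := μ) (fun U => Real.exp (-(t * q (U⁻¹.1 g)))) W]
    refine integral_congr_ae (.of_forall fun U => ?_)
    have : ((W * U)⁻¹).1 g = ‖g‖ • (U⁻¹.1 e) := by
      rw [mul_inv_rev, ← map_smul]
      nth_rewrite 1 [← hW]
      have hc : (W⁻¹).1 * W.1 = 1 := by
        rw [← Submonoid.coe_mul, inv_mul_cancel]; rfl
      change (U⁻¹).1 (((W⁻¹).1 * W.1) (‖g‖ • e)) = _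
      rw [hc]; rfl
    simp only [this, hqs]
  have h3 : ∀ U : unitary (E →L[ℝ] E), Real.exp (-(Module.finrank ℝ E * t * q (U⁻¹.1 e)))
      ≤ ∫ g, Real.exp (-(t * (‖g‖ ^ 2 * q (U⁻¹.1 e)))) ∂(stdGaussian E) := by
    intro U
    have ha : 0 ≤ t * q (U⁻¹.1 e) := mul_nonneg ht (hq0 _)
    have h := exp_neg_le_integral_exp_neg_norm_sq_stdGaussian (E := E) ha
    simpa only [mul_assoc, mul_comm (q _)] using h
  -- Replace `dim E` by `‖g‖²`, trade `‖g‖ • U⁻¹ e` for `U⁻¹ g` by Haar invariance, then remove `U`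
  -- by rotation invariance of the Gaussian.
  calc ∫ U, Real.exp (-(Module.finrank ℝ E * t * q (U⁻¹.1 e))) ∂μ
      ≤ ∫ U, ∫ g, Real.exp (-(t * (‖g‖ ^ 2 * q (U⁻¹.1 e)))) ∂(stdGaussian E) ∂μ := by
        refine integral_mono ?_ ?_ h3
        · exact Integrable.of_bound (C := 1) (Continuous.aestronglyMeasurable (by fun_prop))
            (.of_forall fun U => by
              have := hq0 (U⁻¹.1 e)
              rw [Real.norm_eq_abs, abs_of_pos (Real.exp_pos _), Real.exp_le_one_iff,
                neg_nonpos]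
              positivity)
        · refine (hint (φ := fun z => t * (‖z.2‖ ^ 2 * q (z.1⁻¹.1 e))) ?_ ?_).integral_prod_left
          · exact continuous_const.mul ((by fun_prop : Continuous fun z :
              unitary (E →L[ℝ] E) × E => ‖z.2‖ ^ 2).mul (hq.comp (hinve.comp continuous_fst)))
          · exact fun z => mul_nonneg ht (mul_nonneg (sq_nonneg _) (hq0 _))
    _ = ∫ g, ∫ U, Real.exp (-(t * (‖g‖ ^ 2 * q (U⁻¹.1 e)))) ∂μ ∂(stdGaussian E) := by
        refine integral_integral_swap (hint (φ := fun z => t * (‖z.2‖ ^ 2 * q (z.1⁻¹.1 e))) ?_ ?_)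
        · exact continuous_const.mul ((by fun_prop : Continuous fun z :
            unitary (E →L[ℝ] E) × E => ‖z.2‖ ^ 2).mul (hq.comp (hinve.comp continuous_fst)))
        · exact fun z => mul_nonneg ht (mul_nonneg (sq_nonneg _) (hq0 _))
    _ = ∫ g, ∫ U, Real.exp (-(t * q (U⁻¹.1 g))) ∂μ ∂(stdGaussian E) := by simp_rw [h2]
    _ = ∫ U, ∫ g, Real.exp (-(t * q (U⁻¹.1 g))) ∂(stdGaussian E) ∂μ := by
        refine (integral_integral_swap (hint (φ := fun z => t * q (z.1⁻¹.1 z.2)) ?_ ?_)).symm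
        · exact continuous_const.mul (hq.comp hinv')
        · exact fun z => mul_nonneg ht (hq0 _)
    _ = ∫ g, Real.exp (-(t * q g)) ∂(stdGaussian E) := by simp [h1]

/-- Some isometry satisfies the averaged bound for a finite weighted family of vectors. -/
lemma exists_unitary_sum_exp_le {E : Type*} [NormedAddCommGroup E] [InnerProductSpace ℝ E]
    [FiniteDimensional ℝ E] [MeasurableSpace E] [BorelSpace E]
    {ι : Type*} (s : Finset ι)
    {q : E → ℝ} (hq : Continuous q) (hq0 : ∀ x, 0 ≤ q x)
    (hqs : ∀ (c : ℝ) x, q (c • x) = c ^ 2 * q x)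
    (w : ι → ℝ) (hw : ∀ i, 0 ≤ w i) (d : ι → E) {δ t : ℝ}
    (hδ : 0 < δ) (hd : ∀ i ∈ s, δ ≤ ‖d i‖) (ht : 0 ≤ t) :
    ∃ U : E ≃ₗᵢ[ℝ] E,
      ∑ i ∈ s, w i * Real.exp (-(Module.finrank ℝ E * t * q (U (d i)))) ≤
        (∑ i ∈ s, w i) *
          ∫ g, Real.exp (-(t * δ ^ 2 * q g)) ∂(stdGaussian E) := by
  let : MeasurableSpace (unitary (E →L[ℝ] E)) := borel _
  have : BorelSpace (unitary (E →L[ℝ] E)) := ⟨rfl⟩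
  let μ : Measure (unitary (E →L[ℝ] E)) := Measure.haarMeasure ⊤
  have : IsProbabilityMeasure μ := ⟨by
    simpa using Measure.haarMeasure_self (K₀ := (⊤ : TopologicalSpace.PositiveCompacts
      (unitary (E →L[ℝ] E))))⟩
  have hinv : Continuous fun U : unitary (E →L[ℝ] E) => (U⁻¹).1 :=
    continuous_subtype_val.comp continuous_inv
  have hinve : ∀ e : E, Continuous fun U : unitary (E →L[ℝ] E) => (U⁻¹).1 e :=
    fun e => hinv.clm_apply continuous_const
  have hint : ∀ e : E, ∀ r : ℝ, 0 ≤ r →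
      Integrable (fun U : unitary (E →L[ℝ] E) => Real.exp (-(r * q (U⁻¹.1 e)))) μ := by
    intro e r hr
    have := hinve e
    exact Integrable.of_bound (C := 1) (Continuous.aestronglyMeasurable (by fun_prop))
      (.of_forall fun U => by
        have := hq0 (U⁻¹.1 e)
        rw [Real.norm_eq_abs, abs_of_pos (Real.exp_pos _), Real.exp_le_one_iff, neg_nonpos]
        positivity)
  have hint' : Integrable (fun U : unitary (E →L[ℝ] E) =>
      ∑ i ∈ s, w i * Real.exp (-(Module.finrank ℝ E * t * q (U⁻¹.1 (d i))))) μ :=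
    integrable_finsetSum _ fun i _ => (hint (d i) _ (by positivity)).const_mul _
  -- First-moment method: some `U` does at least as well as the average.
  obtain ⟨U, hU⟩ := exists_le_integral hint'
  refine ⟨Unitary.linearIsometryEquiv U⁻¹, hU.trans ?_⟩
  rw [integral_finsetSum _ fun i _ => (hint (d i) _ (by positivity)).const_mul _, Finset.sum_mul]
  refine Finset.sum_le_sum fun i hi => ?_
  rw [integral_const_mul]
  refine mul_le_mul_of_nonneg_left ?_ (hw i)
  have hpos : 0 < ‖d i‖ := hδ.trans_le (hd i hi)
  refine le_trans ?_ (integral_haar_exp_le_integral_stdGaussian μ hq hq0 hqs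
    (e := ‖d i‖⁻¹ • d i) (by rw [norm_smul, norm_inv, norm_norm, inv_mul_cancel₀ hpos.ne'])
    (t := t * δ ^ 2) (by positivity))
  refine integral_mono (hint _ _ (by positivity)) (hint _ _ (by positivity)) fun U => ?_
  refine Real.exp_le_exp.mpr (neg_le_neg ?_)
  rw [map_smul, hqs]
  have h1 : δ ^ 2 * (‖d i‖⁻¹) ^ 2 ≤ 1 := by
    rw [← mul_pow]
    refine pow_le_one₀ (by positivity) ?_
    rw [← div_eq_mul_inv, div_le_one hpos]
    exact hd i hi
  have h2 : 0 ≤ Module.finrank ℝ E * t * q (U⁻¹.1 (d i)) := mul_nonneg (by positivity) (hq0 _)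
  nlinarith

/-! ### The linear map behind the sensing matrix -/

/-- The linear map `ℝ ^ N → ℝ ^ K` that truncates or pads with zeros. -/
def truncPad (K N : ℕ) : EuclideanSpace ℝ (Fin N) →ₗ[ℝ] EuclideanSpace ℝ (Fin K) where
  toFun x := WithLp.toLp 2 fun k : Fin K => if h : k.1 < N then x ⟨k.1, h⟩ else 0
  map_add' x y := by ext k; by_cases h : k.1 < N <;> simp [h]
  map_smul' c x := by ext k; by_cases h : k.1 < N <;> simp [h]

lemma norm_truncPad_sq {K N : ℕ} (x : EuclideanSpace ℝ (Fin N)) :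
    ‖truncPad K N x‖ ^ 2 = ∑ n : Fin N, (if n.1 < K then 1 else 0) * x n ^ 2 := by
  set f : ℕ → ℝ := fun i => if h : i < N then x ⟨i, h⟩ else 0 with hf
  have h1 : ‖truncPad K N x‖ ^ 2 = ∑ i ∈ Finset.range K, f i ^ 2 := by
    rw [EuclideanSpace.real_norm_sq_eq, ← Fin.sum_univ_eq_sum_range (fun i => f i ^ 2)]
    rfl
  have h2 : ∑ n : Fin N, (if n.1 < K then (1 : ℝ) else 0) * x n ^ 2
      = ∑ i ∈ Finset.range N, (if i < K then (1 : ℝ) else 0) * f i ^ 2 := by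
    rw [← Fin.sum_univ_eq_sum_range (fun i => (if i < K then (1 : ℝ) else 0) * f i ^ 2)]
    simp [hf]
  rw [h1, h2]
  simp only [ite_mul, one_mul, zero_mul, ← Finset.sum_filter]
  refine (Finset.sum_subset (fun i hi => ?_) fun i hi hi' => ?_).symm
  · simp at hi ⊢; exact hi.2
  · simp only [Finset.mem_filter, Finset.mem_range, not_and] at hi hi'
    have : ¬ i < N := fun h => hi' h hi
    simp [hf, this]

lemma norm_truncPad_le {K N : ℕ} (x : EuclideanSpace ℝ (Fin N)) : ‖truncPad K N x‖ ≤ ‖x‖ := by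
  refine (sq_le_sq₀ (norm_nonneg _) (norm_nonneg _)).mp ?_
  rw [norm_truncPad_sq, EuclideanSpace.real_norm_sq_eq]
  refine Finset.sum_le_sum fun n _ => ?_
  split_ifs <;> nlinarith [sq_nonneg (x n)]

lemma norm_truncPad_of_le {K N : ℕ} (h : N ≤ K) (x : EuclideanSpace ℝ (Fin N)) :
    ‖truncPad K N x‖ = ‖x‖ := by
  rw [← sq_eq_sq₀ (norm_nonneg _) (norm_nonneg _), norm_truncPad_sq,
    EuclideanSpace.real_norm_sq_eq]
  refine Finset.sum_congr rfl fun n _ => ?_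
  rw [if_pos (n.2.trans_le h), one_mul]

lemma truncPad_ne_zero {K N : ℕ} (hK : 0 < K) (hN : 0 < N) : truncPad K N ≠ 0 := by
  intro h
  have := norm_truncPad_sq (K := K) (EuclideanSpace.single (⟨0, hN⟩ : Fin N) (1 : ℝ))
  rw [h] at this
  simp [hK] at this

/-- For `N ≤ K` the map is an isometry and the exponentials are deterministic; this converts them to
the form of the Gaussian average. -/
lemma exp_neg_le_one_add_rpow {K : ℕ} (hK : 0 < K) {u : ℝ} (hu : 0 ≤ u) :
    Real.exp (-u) ≤ (1 + 2 * u / K) ^ (-(K : ℝ) / 2) := by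
  have hK' : (0 : ℝ) < K := by exact_mod_cast hK
  rw [Real.rpow_def_of_pos (by positivity)]
  refine Real.exp_le_exp.mpr ?_
  have h := Real.log_le_sub_one_of_pos (x := 1 + 2 * u / K) (by positivity)
  have h2 : Real.log (1 + 2 * u / K) * (K / 2) ≤ (2 * u / K) * (K / 2) :=
    mul_le_mul_of_nonneg_right (by linarith) (by positivity)
  have h3 : (2 * u / K) * (K / 2) = u := by field_simp
  linarith

lemma integral_exp_neg_truncPad {K N : ℕ} (h : K ≤ N) {t : ℝ} (ht : 0 ≤ t) :
    ∫ g, Real.exp (-(t * ‖truncPad K N g‖ ^ 2)) ∂(stdGaussian (EuclideanSpace ℝ (Fin N)))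
      = (1 + 2 * t) ^ (-(K : ℝ) / 2) := by
  have h1 := integral_exp_neg_sum_sq_stdGaussian (ι := Fin N)
    (c := fun n => t * if n.1 < K then 1 else 0) fun n => by positivity
  simp_rw [norm_truncPad_sq, Finset.mul_sum, ← mul_assoc]
  rw [h1]
  have h2 : ∀ n : Fin N, (1 + 2 * (t * if n.1 < K then 1 else 0)) ^ (-(1 : ℝ) / 2)
      = if n.1 < K then (1 + 2 * t) ^ (-(1 : ℝ) / 2) else 1 := by
    intro n
    split_ifs <;> simp
  simp_rw [h2]
  rw [← Finset.prod_filter, Finset.prod_const, ← Real.rpow_natCast, ← Real.rpow_mul (by positivity)]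
  have : (Finset.univ.filter fun n : Fin N => n.1 < K).card = K := by
    rw [Fin.card_filter_val_lt, min_eq_right h]
  rw [this]
  congr 1
  ring

/-- A linear map `ℝ ^ N → ℝ ^ K` of norm at most `√(N / K) + 1` that meets, for a weighted finite
family of vectors, the bound satisfied on average by a matrix of i.i.d. `N(0, 1 / K)` entries. -/
lemma exists_linearMap_sum_exp_le {K N : ℕ} (hK : 0 < K) (hN : 0 < N) {ι : Type*} (s : Finset ι)
    (w : ι → ℝ) (hw : ∀ i, 0 ≤ w i) (d : ι → EuclideanSpace ℝ (Fin N)) {δ τ : ℝ}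
    (hδ : 0 < δ) (hd : ∀ i ∈ s, δ ≤ ‖d i‖) (hτ : 0 ≤ τ) :
    ∃ T : EuclideanSpace ℝ (Fin N) →ₗ[ℝ] EuclideanSpace ℝ (Fin K), T ≠ 0 ∧
      (∀ x, ‖T x‖ ≤ (√((N : ℝ) / K) + 1) * ‖x‖) ∧
      ∑ i ∈ s, w i * Real.exp (-(τ * ‖T (d i)‖ ^ 2)) ≤
        (∑ i ∈ s, w i) * (1 + 2 * (τ * δ ^ 2) / K) ^ (-(K : ℝ) / 2) := by
  have hK' : (0 : ℝ) < K := by exact_mod_cast hK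
  have hN' : (0 : ℝ) < N := by exact_mod_cast hN
  have hsq := Real.sqrt_nonneg ((N : ℝ) / K)
  rcases le_total N K with h | h
  · refine ⟨truncPad K N, truncPad_ne_zero hK hN, fun x => ?_, ?_⟩
    · rw [norm_truncPad_of_le h]
      nlinarith [norm_nonneg x, mul_nonneg hsq (norm_nonneg x)]
    · rw [Finset.sum_mul]
      refine Finset.sum_le_sum fun i hi => mul_le_mul_of_nonneg_left ?_ (hw i)
      refine le_trans ?_ (exp_neg_le_one_add_rpow hK (by positivity))
      rw [norm_truncPad_of_le h]
      have := hd i hi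
      gcongr
  · obtain ⟨U, hU⟩ := exists_unitary_sum_exp_le s (q := fun x => ‖truncPad K N x‖ ^ 2)
      (((truncPad K N).continuous_of_finiteDimensional.norm).pow 2) (fun _ => sq_nonneg _)
      (fun c x => by rw [map_smul, norm_smul, mul_pow, Real.norm_eq_abs, sq_abs])
      w hw d hδ hd (t := τ / K) (by positivity)
    -- The factor `√(N / K)` compensates on average for the `N - K` lost coordinates; with `t = τ /
    -- K` it turns `N * t` back into `τ * (N / K)`.
    set T := √((N : ℝ) / K) • (truncPad K N ∘ₗ U.toLinearEquiv.toLinearMap)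
    have hT : ∀ x, ‖T x‖ = √((N : ℝ) / K) * ‖truncPad K N (U x)‖ := by
      intro x
      have hx : T x = √((N : ℝ) / K) • truncPad K N (U x) := by
        rw [LinearMap.smul_apply]
        rfl
      rw [hx, norm_smul, Real.norm_of_nonneg hsq]
    refine ⟨T, ?_, fun x => ?_, ?_⟩
    · refine smul_ne_zero (by positivity) fun h0 => truncPad_ne_zero hK hN ?_
      ext1 x
      simpa using LinearMap.congr_fun h0 (U.symm x)
    · have h1 : ‖truncPad K N (U x)‖ ≤ ‖x‖ := (norm_truncPad_le _).trans (U.norm_map x).le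
      rw [hT]
      nlinarith [norm_nonneg x, mul_le_mul_of_nonneg_left h1 hsq]
    · rw [integral_exp_neg_truncPad h (by positivity), finrank_euclideanSpace, Fintype.card_fin]
        at hU
      simp_rw [hT, mul_pow, Real.sq_sqrt (show 0 ≤ (N : ℝ) / K by positivity)]
      have h1 : ∀ u : ℝ, τ * (N / K * u) = N * (τ / K) * u := fun u => by ring
      simp_rw [h1]
      rwa [show 2 * (τ * δ ^ 2) / K = 2 * (τ / K * δ ^ 2) by ring]

/-! ### Whitened sensing matrices -/

open scoped Matrix

lemma largestEigenvalue_nonneg {N : ℕ} {S : Matrix (Fin N) (Fin N) ℝ} (hS : S.PosSemidef) :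
    0 ≤ largestEigenvalue hS.isHermitian :=
  Real.iSup_nonneg fun i => hS.eigenvalues_nonneg i

open scoped MatrixOrder in
lemma posSemidef_largestEigenvalue_smul_one_sub {N : ℕ} {S : Matrix (Fin N) (Fin N) ℝ}
    (hS : S.IsHermitian) :
    (largestEigenvalue hS • (1 : Matrix (Fin N) (Fin N) ℝ) - S).PosSemidef := by
  rw [← Matrix.le_iff, ← Algebra.algebraMap_eq_smul_one]
  refine le_algebraMap_of_spectrum_le (fun x hx => ?_) hS.isSelfAdjoint
  rw [hS.spectrum_real_eq_range_eigenvalues] at hx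
  obtain ⟨i, rfl⟩ := hx
  exact le_ciSup (f := hS.eigenvalues) (Set.finite_range _).bddAbove i

lemma norm_adjoint_apply_le {E F : Type*} [NormedAddCommGroup E] [InnerProductSpace ℝ E]
    [FiniteDimensional ℝ E] [NormedAddCommGroup F] [InnerProductSpace ℝ F]
    [FiniteDimensional ℝ F] {T : E →ₗ[ℝ] F} {c : ℝ} (hc : 0 ≤ c)
    (hT : ∀ x, ‖T x‖ ≤ c * ‖x‖) (y : F) :
    ‖LinearMap.adjoint T y‖ ≤ c * ‖y‖ := by
  have h1 : ‖LinearMap.adjoint T y‖ ^ 2 ≤ ‖y‖ * (c * ‖LinearMap.adjoint T y‖) := by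
    rw [← real_inner_self_eq_norm_sq, LinearMap.adjoint_inner_left]
    exact (real_inner_le_norm _ _).trans (mul_le_mul_of_nonneg_left (hT _) (norm_nonneg _))
  rcases (norm_nonneg (LinearMap.adjoint T y)).eq_or_lt with h | h
  · rw [← h]
    positivity
  · nlinarith

/-- With `lam` the largest eigenvalue, `1 - A S Aᵀ = (1 - lam • A Aᵀ) + A (lam • 1 - S) Aᵀ`: the
first summand is positive definite since `‖Aᵀ x‖ ≤ c ‖x‖`, the second positive semidefinite. -/
lemma posDef_one_sub_mul_mul_transpose {K N : ℕ} {S : Matrix (Fin N) (Fin N) ℝ}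
    (hS : S.PosSemidef) {A : Matrix (Fin K) (Fin N) ℝ} {c : ℝ} (hc : 0 ≤ c)
    (hA : ∀ x, ‖Matrix.toEuclideanLin A x‖ ≤ c * ‖x‖)
    (hlt : largestEigenvalue hS.isHermitian * c ^ 2 < 1) :
    (1 - A * S * Aᵀ).PosDef := by
  set lam := largestEigenvalue hS.isHermitian
  have h0 : 0 ≤ lam := largestEigenvalue_nonneg hS
  have h1 : (A * (lam • (1 : Matrix (Fin N) (Fin N) ℝ) - S) * Aᵀ).PosSemidef := by
    have := (posSemidef_largestEigenvalue_smul_one_sub hS.isHermitian).mul_mul_conjTranspose_same A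
    rwa [Matrix.conjTranspose_eq_transpose_of_trivial] at this
  have h2 : (1 - lam • (A * Aᵀ)).PosDef := by
    refine Matrix.PosDef.of_dotProduct_mulVec_pos ?_ fun x hx => ?_
    · refine Matrix.isHermitian_one.sub ?_
      simp [Matrix.IsHermitian]
    · have h3 : ∀ n (v : Fin n → ℝ), v ⬝ᵥ v = ‖WithLp.toLp 2 v‖ ^ 2 := fun n v => by
        rw [EuclideanSpace.real_norm_sq_eq]
        simp [dotProduct, sq]
      have h4 := norm_adjoint_apply_le hc hA (WithLp.toLp 2 x)
      rw [← Matrix.toEuclideanLin_conjTranspose_eq_adjoint] at h4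
      have h5 : 0 < ‖WithLp.toLp 2 x‖ := by simpa using hx
      have h6 : star x ⬝ᵥ ((1 - lam • (A * Aᵀ)).mulVec x)
          = ‖WithLp.toLp 2 x‖ ^ 2 - lam * ‖Matrix.toEuclideanLin Aᴴ (WithLp.toLp 2 x)‖ ^ 2 := by
        rw [Matrix.toLpLin_toLp, ← h3, ← h3, Matrix.sub_mulVec, Matrix.one_mulVec,
          dotProduct_sub, Matrix.smul_mulVec, dotProduct_smul, ← Matrix.mulVec_mulVec,
          Matrix.dotProduct_mulVec (star x) A, ← Matrix.mulVec_transpose]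
        simp [Matrix.conjTranspose_eq_transpose_of_trivial]
      rw [h6]
      have h7 := mul_le_mul_of_nonneg_left (pow_le_pow_left₀ (norm_nonneg _) h4 2) h0
      have h8 : 0 < ‖WithLp.toLp 2 x‖ ^ 2 := by positivity
      nlinarith
  have h3 : 1 - A * S * Aᵀ = (1 - lam • (A * Aᵀ))
      + A * (lam • (1 : Matrix (Fin N) (Fin N) ℝ) - S) * Aᵀ := by
    rw [Matrix.mul_sub, Matrix.sub_mul]
    simp
  rw [h3]
  exact h2.add_posSemidef h1

open scoped MatrixOrder in
/-- A matrix `A` such that `1 - A Σ Aᵀ` is positive definite is a whitened sensing matrix. -/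
lemma isWhitenedSensing_of_posDef {K N : ℕ} {S : Matrix (Fin N) (Fin N) ℝ} {σ : ℝ} (hσ : 0 < σ)
    {A : Matrix (Fin K) (Fin N) ℝ} (h : (1 - A * S * Aᵀ).PosDef) :
    IsWhitenedSensing S σ A := by
  set Q := 1 - A * S * Aᵀ with hQ
  set R := CFC.sqrt Q
  have hRR : R * R = Q := CFC.sqrt_mul_sqrt_self Q h.posSemidef.nonneg
  have hR : R.PosDef := by
    rw [← Matrix.isStrictlyPositive_iff_posDef] at h ⊢
    exact h.sqrt
  have hRT : R.transpose = R := by simpa using hR.isHermitian.eq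
  have hu : IsUnit R.det := (Matrix.isUnit_iff_isUnit_det _).mp hR.isUnit
  -- With `R² = 1 - A S Aᵀ` and `Φ = σ R⁻¹ A`, the total noise covariance is `σ² (R⁻¹ (1 - R²) R⁻¹ +
  -- 1) = σ² R⁻²`, whose inverse square root is `σ⁻¹ R`.
  refine ⟨σ • (R⁻¹ * A), σ⁻¹ • R, ⟨hR.smul (by positivity), ?_⟩, ?_⟩
  · have h1 : A * S * Aᵀ = 1 - R * R := by rw [hRR, hQ]; abel
    have h2 : σ • (R⁻¹ * A) * S * (σ • (R⁻¹ * A)).transpose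
        = σ ^ 2 • (R⁻¹ * (A * S * Aᵀ) * R⁻¹) := by
      rw [Matrix.transpose_smul, Matrix.transpose_mul, Matrix.transpose_nonsing_inv, hRT]
      simp only [Matrix.smul_mul, Matrix.mul_smul, smul_smul, Matrix.mul_assoc, sq]
    have h3 : R⁻¹ * (1 - R * R) * R⁻¹ = R⁻¹ * R⁻¹ - 1 := by
      rw [Matrix.mul_sub, Matrix.mul_one, ← Matrix.mul_assoc, Matrix.nonsing_inv_mul _ hu,
        Matrix.one_mul, Matrix.sub_mul, Matrix.mul_nonsing_inv _ hu]
    have h4 : R * R * (R⁻¹ * R⁻¹) = 1 := by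
      rw [Matrix.mul_assoc, ← Matrix.mul_assoc R R⁻¹, Matrix.mul_nonsing_inv _ hu, Matrix.one_mul,
        Matrix.mul_nonsing_inv _ hu]
    rw [h2, h1, h3, ← smul_add, sub_add_cancel]
    simp only [Matrix.smul_mul, Matrix.mul_smul, smul_smul, h4]
    rw [show σ ^ 2 * (σ⁻¹ * σ⁻¹) = 1 by field_simp, one_smul]
  · rw [Matrix.smul_mul, Matrix.mul_smul, smul_smul, inv_mul_cancel₀ hσ.ne', one_smul,
      ← Matrix.mul_assoc, Matrix.mul_nonsing_inv _ hu, Matrix.one_mul]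

/-! ### The Bhattacharyya bound -/

section Gaussian

variable {E : Type*} [NormedAddCommGroup E] [InnerProductSpace ℝ E]
    [FiniteDimensional ℝ E] [MeasurableSpace E] [BorelSpace E]

/-- Chernoff (Bhattacharyya) bound for the test between two Gaussian classes. -/
lemma mul_stdGaussian_real_le {r s : ℝ} (hr : 0 < r) (hs : 0 < s) (v : E) :
    r * (stdGaussian E).real
      {n | -(‖n‖ ^ 2 / 2) + Real.log r ≤ -(‖n - v‖ ^ 2 / 2) + Real.log s}
      ≤ √(r * s) * Real.exp (-(‖v‖ ^ 2 / 8)) := by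
  obtain ⟨hi, hI⟩ := integral_exp_inner_stdGaussian ((1 / 2 : ℝ) • v)
  -- `b * exp ⟪v / 2, n⟫` is the square root of the posterior ratio of the two classes. The event
  -- says that it is at least `1`, so Markov's inequality applies.
  set b := √(s / r) * Real.exp (-(‖v‖ ^ 2 / 4)) with hb
  have hb0 : 0 < b := by positivity
  have h1 : (stdGaussian E).real
      {n | -(‖n‖ ^ 2 / 2) + Real.log r ≤ -(‖n - v‖ ^ 2 / 2) + Real.log s}
      ≤ b * Real.exp (‖v‖ ^ 2 / 8) := by
    calc _ ≤ (stdGaussian E).real {n | 1 ≤ b * Real.exp (inner ℝ ((1 / 2 : ℝ) • v) n)} := by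
          refine measureReal_mono fun n hn => ?_
          simp only [Set.mem_ofPred_eq] at hn ⊢
          have h2 : b * Real.exp (inner ℝ ((1 / 2 : ℝ) • v) n)
              = Real.exp ((Real.log s - Real.log r) / 2 - ‖v‖ ^ 2 / 4 + inner ℝ n v / 2) := by
            rw [hb, Real.sqrt_eq_rpow, Real.rpow_def_of_pos (by positivity),
              Real.log_div hs.ne' hr.ne', ← Real.exp_add, ← Real.exp_add, real_inner_smul_left,
              real_inner_comm]
            congr 1
            ring
          rw [h2, Real.one_le_exp_iff]
          rw [norm_sub_sq_real] at hn
          linarith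
      _ ≤ ∫ n, b * Real.exp (inner ℝ ((1 / 2 : ℝ) • v) n) ∂(stdGaussian E) := by
          have := mul_meas_ge_le_integral_of_nonneg (μ := stdGaussian E)
            (.of_forall fun n => by positivity) (hi.const_mul b) 1
          rwa [one_mul] at this
      _ = b * Real.exp (‖v‖ ^ 2 / 8) := by
          rw [integral_const_mul, hI, norm_smul, mul_pow]
          congr 2
          norm_num
          ring
  calc _ ≤ r * (b * Real.exp (‖v‖ ^ 2 / 8)) := mul_le_mul_of_nonneg_left h1 hr.le
    _ = (r * √(s / r)) * (Real.exp (-(‖v‖ ^ 2 / 4)) * Real.exp (‖v‖ ^ 2 / 8)) := by rw [hb]; ring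
    _ = _ := by
      rw [← Real.exp_add]
      congr 2
      · rw [eq_comm, Real.sqrt_eq_iff_mul_self_eq (by positivity) (by positivity)]
        have := Real.mul_self_sqrt (show 0 ≤ s / r by positivity)
        rw [mul_mul_mul_comm, this]
        field_simp
      · ring

end Gaussian

/-! ### False discovery proportions for independent locations -/

lemma isProbabilityMeasure_prior {m : ℕ} {p : Fin m → ℝ} (hp : ∀ j, 0 ≤ p j)
    (hs : ∑ j, p j = 1) : IsProbabilityMeasure (prior p) := by
  constructor
  simp only [prior, Measure.coe_finsetSum, Finset.sum_apply, Measure.smul_apply, measure_univ,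
    smul_eq_mul, mul_one]
  rw [← ENNReal.ofReal_sum_of_nonneg fun j _ => hp j, hs, ENNReal.ofReal_one]

lemma prior_prod_real_apply {m : ℕ} {p : Fin m → ℝ} (hp : ∀ j, 0 ≤ p j) {Ω : Type*}
    [MeasurableSpace Ω] (γ : Measure Ω) [IsProbabilityMeasure γ] {B : Set (Fin m × Ω)}
    (hB : MeasurableSet B) :
    ((prior p).prod γ).real B = ∑ k, p k * γ.real {n | (k, n) ∈ B} := by
  rw [measureReal_def, Measure.prod_apply hB, prior, lintegral_finsetSum_measure]
  simp only [lintegral_smul_measure, lintegral_dirac, smul_eq_mul]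
  rw [ENNReal.toReal_sum fun k _ => ENNReal.mul_ne_top ENNReal.ofReal_ne_top (measure_ne_top _ _)]
  refine Finset.sum_congr rfl fun k _ => ?_
  rw [ENNReal.toReal_mul, ENNReal.toReal_ofReal (hp k)]
  rfl

section FalseDiscovery

variable {M : ℕ} {Ω : Type*} [MeasurableSpace Ω] (ν : Measure Ω) [IsProbabilityMeasure ν]

/-- On `H ⊆ G i` the `i`-th term of the denominator equals `1`, so the remaining factor depends only
on the other coordinates and is independent of `ω i`. Hence `J = 𝔼 [1 / (1 + ∑ k ≠ i)]` serves every
such `H`, and it cancels when `H i` is compared with `G i`. -/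
lemma integral_indicator_div_sum {G : Fin M → Set Ω} (hG : ∀ i, MeasurableSet (G i)) (i : Fin M) :
    ∃ J : ℝ, 0 ≤ J ∧ ∀ H : Set Ω, MeasurableSet H → H ⊆ G i →
      ∫ ω, H.indicator (1 : Ω → ℝ) (ω i) / ∑ k, (G k).indicator (1 : Ω → ℝ) (ω k)
        ∂(Measure.pi fun _ : Fin M => ν) = ν.real H * J := by
  set μ := Measure.pi fun _ : Fin M => ν
  have hmeas : ∀ k, Measurable ((G k).indicator (1 : Ω → ℝ)) := fun k =>
    measurable_one.indicator (hG k)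
  have hnn : ∀ k x, 0 ≤ (G k).indicator (1 : Ω → ℝ) x := fun k x =>
    Set.indicator_nonneg (fun _ _ => zero_le_one) x
  set W : (Fin M → Ω) → ℝ := fun ω =>
    (1 + ∑ k ∈ Finset.univ.erase i, (G k).indicator (1 : Ω → ℝ) (ω k))⁻¹ with hW
  refine ⟨∫ ω, W ω ∂μ, integral_nonneg fun ω => inv_nonneg.mpr
    (add_nonneg zero_le_one (Finset.sum_nonneg fun k _ => hnn k _)), fun H hH hHG => ?_⟩
  have hHm : Measurable (H.indicator (1 : Ω → ℝ)) := measurable_one.indicator hH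
  have h1 : ∀ ω : Fin M → Ω, H.indicator (1 : Ω → ℝ) (ω i) /
      ∑ k, (G k).indicator (1 : Ω → ℝ) (ω k) = H.indicator (1 : Ω → ℝ) (ω i) * W ω := by
    intro ω
    by_cases h : ω i ∈ H
    · rw [hW, ← Finset.add_sum_erase _ _ (Finset.mem_univ i),
        Set.indicator_of_mem (hHG h), Pi.one_apply, div_eq_mul_inv]
    · simp [h]
  simp_rw [h1]
  have hind : iIndepFun (fun k (ω : Fin M → Ω) => ω k) μ :=
    iIndepFun_pi (X := fun _ => id) fun _ => aemeasurable_id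
  have hφ : Measurable fun x : (({i} : Finset (Fin M)) → Ω) =>
      H.indicator (1 : Ω → ℝ) (x ⟨i, by simp⟩) := hHm.comp (measurable_pi_apply _)
  have hψ : Measurable fun x : (Finset.univ.erase i → Ω) =>
      (1 + ∑ k : Finset.univ.erase i, (G k).indicator (1 : Ω → ℝ) (x k))⁻¹ := by
    have h (k : Finset.univ.erase i) : Measurable fun x : (Finset.univ.erase i → Ω) =>
      (G k).indicator (1 : Ω → ℝ) (x k) := (hmeas k).comp (measurable_pi_apply k)
    fun_prop
  have h2 := (hind.indepFun_finset {i} (Finset.univ.erase i) (by simp)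
    fun k => measurable_pi_apply k).comp hφ hψ
  have h3 : (fun x : (Finset.univ.erase i → Ω) =>
      (1 + ∑ k : Finset.univ.erase i, (G k).indicator (1 : Ω → ℝ) (x k))⁻¹) ∘
      (fun (ω : Fin M → Ω) (k : Finset.univ.erase i) => ω k) = W := by
    funext ω
    simp only [Function.comp_apply, hW]
    rw [Finset.sum_coe_sort (Finset.univ.erase i) fun k => (G k).indicator (1 : Ω → ℝ) (ω k)]
  rw [h3] at h2
  have hWm : Measurable W := by
    have h (k : Fin M) : Measurable fun ω : Fin M → Ω => (G k).indicator (1 : Ω → ℝ) (ω k) :=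
      (hmeas k).comp (measurable_pi_apply k)
    fun_prop
  have h4 := h2.integral_fun_mul_eq_mul_integral
    ((hHm.comp (measurable_pi_apply i)).aestronglyMeasurable) hWm.aestronglyMeasurable
  refine h4.trans ?_
  congr 1
  rw [← integral_indicator_one hH, ← (measurePreserving_eval (fun _ : Fin M => ν) i).map_eq,
    integral_map (measurable_pi_apply i).aemeasurable hHm.aestronglyMeasurable]
  rfl

/-- If each rejected hypothesis is true with conditional probability at most `c`, then so is the
expected false discovery proportion, relative to the probability of a rejection. -/
lemma integral_sum_div_sum_le {G H : Fin M → Set Ω} (hG : ∀ i, MeasurableSet (G i))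
    (hH : ∀ i, MeasurableSet (H i)) (hHG : ∀ i, H i ⊆ G i) {c : ℝ}
    (hc : ∀ i, ν.real (H i) ≤ c * ν.real (G i)) :
    ∫ ω, (∑ i, (H i).indicator (1 : Ω → ℝ) (ω i)) / ∑ k, (G k).indicator (1 : Ω → ℝ) (ω k)
        ∂(Measure.pi fun _ : Fin M => ν)
      ≤ c * (Measure.pi fun _ : Fin M => ν).real
          {ω | 0 < ∑ k, (G k).indicator (1 : Ω → ℝ) (ω k)} := by
  set μ := Measure.pi fun _ : Fin M => ν
  have hmeas : ∀ k, Measurable fun ω : Fin M → Ω => (G k).indicator (1 : Ω → ℝ) (ω k) := fun k =>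
    (measurable_one.indicator (hG k)).comp (measurable_pi_apply k)
  have hRm : Measurable fun ω : Fin M → Ω => ∑ k, (G k).indicator (1 : Ω → ℝ) (ω k) :=
    Finset.measurable_sum _ fun k _ => hmeas k
  have hnn : ∀ (A : Set Ω) x, 0 ≤ A.indicator (1 : Ω → ℝ) x := fun A x =>
    Set.indicator_nonneg (fun _ _ => zero_le_one) x
  have hint : ∀ (i : Fin M) (A : Set Ω), MeasurableSet A → A ⊆ G i → Integrable
      (fun ω => A.indicator (1 : Ω → ℝ) (ω i) / ∑ k, (G k).indicator (1 : Ω → ℝ) (ω k)) μ := by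
    intro i A hA hAG
    refine Integrable.of_bound (C := 1) (((measurable_one.indicator hA).comp
      (measurable_pi_apply i)).div hRm).aestronglyMeasurable (.of_forall fun ω => ?_)
    have h0 : 0 ≤ ∑ k, (G k).indicator (1 : Ω → ℝ) (ω k) := Finset.sum_nonneg fun k _ => hnn _ _
    rw [Real.norm_of_nonneg (div_nonneg (hnn _ _) h0)]
    refine div_le_one_of_le₀ ?_ h0
    refine le_trans ?_ (Finset.single_le_sum (f := fun k => (G k).indicator (1 : Ω → ℝ) (ω k))
      (fun k _ => hnn _ _) (Finset.mem_univ i))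
    exact Set.indicator_le_indicator_of_subset hAG (fun _ => zero_le_one) _
  choose J hJ0 hJ using integral_indicator_div_sum ν hG
  simp_rw [Finset.sum_div]
  rw [integral_finsetSum _ fun i _ => hint i _ (hH i) (hHG i)]
  calc ∑ i, ∫ ω, (H i).indicator (1 : Ω → ℝ) (ω i) / ∑ k, (G k).indicator (1 : Ω → ℝ) (ω k) ∂μ
      ≤ ∑ i, c * ∫ ω, (G i).indicator (1 : Ω → ℝ) (ω i) /
          ∑ k, (G k).indicator (1 : Ω → ℝ) (ω k) ∂μ := by
        refine Finset.sum_le_sum fun i _ => ?_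
        rw [hJ i _ (hH i) (hHG i), hJ i _ (hG i) subset_rfl, ← mul_assoc]
        exact mul_le_mul_of_nonneg_right (hc i) (hJ0 i)
    -- Summed over `i`, the ratios become `R / R`, which is the indicator of `R > 0` because `0 / 0
    -- = 0`.
    _ = c * ∫ ω, {ω : Fin M → Ω | 0 < ∑ k, (G k).indicator (1 : Ω → ℝ) (ω k)}.indicator 1 ω ∂μ := by
        rw [← Finset.mul_sum, ← integral_finsetSum _ fun i _ => hint i _ (hG i) subset_rfl]
        congr 2
        funext ω
        rw [← Finset.sum_div]
        have h0 : 0 ≤ ∑ k, (G k).indicator (1 : Ω → ℝ) (ω k) :=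
          Finset.sum_nonneg fun k _ => hnn _ _
        rcases h0.eq_or_lt with h | h
        · rw [Set.indicator_of_notMem (by simp [← h]), ← h, div_zero]
        · rw [Set.indicator_of_mem (by exact h), div_self h.ne', Pi.one_apply]
    _ = _ := by rw [integral_indicator_one (measurableSet_lt measurable_const hRm)]

end FalseDiscovery

end DSD

/-! ### Rejection probabilities and the bound on pFDR -/

noncomputable section

namespace DSD

section Rejection

variable {m M K N : ℕ}

lemma stdGaussian_logPosterior_le (f : Fin m → EuclideanSpace ℝ (Fin N)) {p : Fin m → ℝ}
    (hp : ∀ j, 0 < p j) (a : ℝ) (A : Matrix (Fin K) (Fin N) ℝ) (k l : Fin m) :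
    p k * (stdGaussian (EuclideanSpace ℝ (Fin K))).real
      {n | logPosterior f p a A k (a • Matrix.toEuclideanLin A (f k) + n)
        ≤ logPosterior f p a A l (a • Matrix.toEuclideanLin A (f k) + n)}
      ≤ √(p k * p l) * Real.exp (-(a ^ 2 / 8 * ‖Matrix.toEuclideanLin A (f k - f l)‖ ^ 2)) := by
  have h := mul_stdGaussian_real_le (hp k) (hp l)
    (a • Matrix.toEuclideanLin A (f l) - a • Matrix.toEuclideanLin A (f k))
  have hv : ‖a • Matrix.toEuclideanLin A (f l) - a • Matrix.toEuclideanLin A (f k)‖ ^ 2 / 8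
      = a ^ 2 / 8 * ‖Matrix.toEuclideanLin A (f k - f l)‖ ^ 2 := by
    rw [← smul_sub, ← map_sub, norm_smul, mul_pow, Real.norm_eq_abs, sq_abs, ← neg_sub (f k),
      map_neg, norm_neg]
    ring
  rw [hv] at h
  refine le_trans (le_of_eq ?_) h
  congr 2
  ext n
  have h1 : a • Matrix.toEuclideanLin A (f k) + n - a • Matrix.toEuclideanLin A (f l)
      = n - (a • Matrix.toEuclideanLin A (f l) - a • Matrix.toEuclideanLin A (f k)) := by abel
  simp only [Set.mem_ofPred_eq, logPosterior, add_sub_cancel_left, h1]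
  constructor <;> intro h <;> linarith

/-- The pairs of a class label and a noise vector for which the null hypothesis `j` is rejected. -/
def rejectSet (f : Fin m → EuclideanSpace ℝ (Fin N)) (p : Fin m → ℝ) (a : ℝ)
    (A : Matrix (Fin K) (Fin N) ℝ) (j : Fin m) : Set (Fin m × EuclideanSpace ℝ (Fin K)) :=
  {z | a • Matrix.toEuclideanLin A (f z.1) + z.2 ∈ sigRegion f p a A j}

/-- Bhattacharyya bound on the probability of confusing class `j` with another class. -/
def confusionBound (f : Fin m → EuclideanSpace ℝ (Fin N)) (p : Fin m → ℝ) (a : ℝ)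
    (A : Matrix (Fin K) (Fin N) ℝ) (j : Fin m) : ℝ :=
  ∑ l ∈ Finset.univ.erase j, √(p j * p l) *
    Real.exp (-(a ^ 2 / 8 * ‖Matrix.toEuclideanLin A (f j - f l)‖ ^ 2))

variable (f : Fin m → EuclideanSpace ℝ (Fin N)) (p : Fin m → ℝ) (a : ℝ)
    (A : Matrix (Fin K) (Fin N) ℝ) (j : Fin m)

lemma measurableSet_sigRegion : MeasurableSet (sigRegion f p a A j) := by
  have h : sigRegion f p a A j = ⋃ l ∈ Finset.univ.erase j,
      {y | logPosterior f p a A j y ≤ logPosterior f p a A l y} := by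
    ext y; simp [sigRegion]
  rw [h]
  refine Finset.measurableSet_biUnion _ fun l _ => measurableSet_le ?_ ?_ <;>
  · unfold logPosterior
    fun_prop

lemma measurableSet_rejectSet : MeasurableSet (rejectSet f p a A j) := by
  refine measurableSet_sigRegion f p a A j |>.preimage ?_
  refine measurable_from_prod_countable_right fun k => ?_
  fun_prop

variable {p}

lemma measurableSet_fst_eq : MeasurableSet {z : Fin m × EuclideanSpace ℝ (Fin K) | z.1 = j} :=
  measurable_fst (measurableSet_singleton j)

lemma rejectSet_inter_real_le (hp : ∀ j, 0 < p j) :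
    ((prior p).prod (stdGaussian (EuclideanSpace ℝ (Fin K)))).real
      (rejectSet f p a A j ∩ {z | z.1 = j}) ≤ confusionBound f p a A j := by
  rw [prior_prod_real_apply (fun j => (hp j).le) _ ((measurableSet_rejectSet f p a A j).inter
    (measurableSet_fst_eq j)), Finset.sum_eq_single j]
  · calc _ ≤ p j * (stdGaussian (EuclideanSpace ℝ (Fin K))).real (⋃ l ∈ Finset.univ.erase j,
          {n | logPosterior f p a A j (a • Matrix.toEuclideanLin A (f j) + n)
            ≤ logPosterior f p a A l (a • Matrix.toEuclideanLin A (f j) + n)}) := by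
          refine mul_le_mul_of_nonneg_left (measureReal_mono ?_ (measure_ne_top _ _)) (hp j).le
          rintro n ⟨⟨l, hl, h⟩, -⟩
          exact Set.mem_biUnion (by simpa using hl) h
      _ ≤ p j * ∑ l ∈ Finset.univ.erase j, (stdGaussian (EuclideanSpace ℝ (Fin K))).real
          {n | logPosterior f p a A j (a • Matrix.toEuclideanLin A (f j) + n)
            ≤ logPosterior f p a A l (a • Matrix.toEuclideanLin A (f j) + n)} :=
          mul_le_mul_of_nonneg_left (measureReal_biUnion_finset_le _ _) (hp j).le
      _ ≤ _ := by
          rw [Finset.mul_sum]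
          exact Finset.sum_le_sum fun l _ => stdGaussian_logPosterior_le f hp a A j l
  · intro k _ hk
    simp [hk]
  · simp

/-- If `j` is not rejected, it beats the true class `l` in particular. The pairwise bound is
symmetric in the two classes, so the same `confusionBound` appears. -/
lemma rejectSet_compl_inter_real_le (hp : ∀ j, 0 < p j) :
    ((prior p).prod (stdGaussian (EuclideanSpace ℝ (Fin K)))).real
      ({z | z.1 ≠ j} \ rejectSet f p a A j) ≤ confusionBound f p a A j := by
  change (Measure.prod _ _).real ({z | z.1 = j}ᶜ \ rejectSet f p a A j) ≤ _
  rw [prior_prod_real_apply (fun j => (hp j).le) _ (MeasurableSet.diff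
    (measurableSet_fst_eq j).compl (measurableSet_rejectSet f p a A j)),
    ← Finset.add_sum_erase _ _ (Finset.mem_univ j)]
  have h0 : {n : EuclideanSpace ℝ (Fin K) | (j, n) ∈ {z : Fin m × EuclideanSpace ℝ (Fin K) |
      z.1 = j}ᶜ \ rejectSet f p a A j} = ∅ := by
    ext n; simp
  rw [h0, measureReal_empty, mul_zero, zero_add]
  refine Finset.sum_le_sum fun l hl => ?_
  have h := stdGaussian_logPosterior_le f hp a A l j
  rw [mul_comm (p l) (p j), ← neg_sub (f j), map_neg, norm_neg] at h
  refine le_trans (mul_le_mul_of_nonneg_left (measureReal_mono ?_) (hp l).le) h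
  rintro n ⟨-, hn⟩
  by_contra hlt
  exact hn ⟨l, (Finset.mem_erase.mp hl).1, (not_le.mp hlt).le⟩

lemma le_rejectSet_real (hp : ∀ j, 0 < p j) (hs : ∑ j, p j = 1) :
    ((prior p).prod (stdGaussian (EuclideanSpace ℝ (Fin K)))).real
      (rejectSet f p a A j ∩ {z | z.1 = j}) + (1 - p j) - confusionBound f p a A j ≤
    ((prior p).prod (stdGaussian (EuclideanSpace ℝ (Fin K)))).real (rejectSet f p a A j) := by
  have := isProbabilityMeasure_prior (fun j => (hp j).le) hs
  set ν := (prior p).prod (stdGaussian (EuclideanSpace ℝ (Fin K)))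
  have hj : MeasurableSet {z : Fin m × EuclideanSpace ℝ (Fin K) | z.1 = j} :=
    measurableSet_fst_eq j
  have h1 : ν.real {z | z.1 ≠ j} = 1 - p j := by
    have h := probReal_compl_eq_one_sub (μ := ν) hj
    rw [prior_prod_real_apply (fun j => (hp j).le) _ hj, Finset.sum_eq_single j] at h
    · simpa [Set.compl_ofPred] using h
    · intro k _ hk; simp [hk]
    · simp
  have h2 := rejectSet_compl_inter_real_le f a A j hp
  have h3 := measureReal_inter_add_sdiff (μ := ν) (s := rejectSet f p a A j) hj
  have h4 := measureReal_inter_add_sdiff (μ := ν)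
    (s := {z : Fin m × EuclideanSpace ℝ (Fin K) | z.1 ≠ j})
    (measurableSet_rejectSet f p a A j)
  have h5 : {z : Fin m × EuclideanSpace ℝ (Fin K) | z.1 ≠ j} ∩ rejectSet f p a A j
      = rejectSet f p a A j \ {z | z.1 = j} := by
    ext z; simp [and_comm]
  rw [h5] at h4
  linarith

lemma rejectSet_real_pos (hp : ∀ j, 0 < p j) (hs : ∑ j, p j = 1) (h : confusionBound f p a A j < 1 - p j) :
    0 < ((prior p).prod (stdGaussian (EuclideanSpace ℝ (Fin K)))).real
      (rejectSet f p a A j) := by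
  have h1 := le_rejectSet_real f a A j hp hs
  have h2 : 0 ≤ ((prior p).prod (stdGaussian (EuclideanSpace ℝ (Fin K)))).real
      (rejectSet f p a A j ∩ {z | z.1 = j}) := measureReal_nonneg
  linarith

/-- Let `x` be the probability of a false rejection. The probability of rejection is at least `x +
(1 - p j) - b`, and `x / (x + (1 - p j) - b)` increases with `x ≤ b`. -/
lemma rejectSet_inter_real_le_mul (hp : ∀ j, 0 < p j) (hs : ∑ j, p j = 1) {b : ℝ}
    (hb : confusionBound f p a A j ≤ b) (hb1 : b < 1 - p j) :
    ((prior p).prod (stdGaussian (EuclideanSpace ℝ (Fin K)))).real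
      (rejectSet f p a A j ∩ {z | z.1 = j}) ≤ b / (1 - p j) *
    ((prior p).prod (stdGaussian (EuclideanSpace ℝ (Fin K)))).real (rejectSet f p a A j) := by
  have h1 := le_rejectSet_real f a A j hp hs
  have h2 := rejectSet_inter_real_le f a A j hp
  have h3 : 0 ≤ ((prior p).prod (stdGaussian (EuclideanSpace ℝ (Fin K)))).real
      (rejectSet f p a A j ∩ {z | z.1 = j}) := measureReal_nonneg
  set x := ((prior p).prod (stdGaussian (EuclideanSpace ℝ (Fin K)))).real
      (rejectSet f p a A j ∩ {z | z.1 = j})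
  set y := ((prior p).prod (stdGaussian (EuclideanSpace ℝ (Fin K)))).real (rejectSet f p a A j)
  have h4 : 0 < 1 - p j := by linarith
  rw [div_mul_eq_mul_div, le_div_iff₀ h4]
  have h5 : b * (x + (1 - p j) - b) ≤ b * y := mul_le_mul_of_nonneg_left (by linarith) (by linarith)
  nlinarith [mul_nonneg (show 0 ≤ b - x by linarith) (show 0 ≤ 1 - p j - b by linarith)]

variable (p) (α : Fin M → ℝ)

lemma numRejected_eq (ω : Fin M → Fin m × EuclideanSpace ℝ (Fin K)) :
    numRejected f p α A j ω = ∑ i, (rejectSet f p (α i) A j).indicator 1 (ω i) := by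
  classical
  refine Finset.sum_congr rfl fun i _ => ?_
  rw [Set.indicator_apply]
  congr

lemma numFalselyRejected_eq (hf : Function.Injective f)
    (ω : Fin M → Fin m × EuclideanSpace ℝ (Fin K)) :
    numFalselyRejected f p α A j ω
      = ∑ i, (rejectSet f p (α i) A j ∩ {z | z.1 = j}).indicator 1 (ω i) := by
  classical
  refine Finset.sum_congr rfl fun i _ => ?_
  have h1 : obs f α A i ω ∈ sigRegion f p (α i) A j ↔ ω i ∈ rejectSet f p (α i) A j := Iff.rfl
  have h2 : target f i ω = f j ↔ (ω i).1 = j := hf.eq_iff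
  simp only [h1, h2, Set.indicator_apply, Set.mem_inter_iff, Set.mem_ofPred_eq, Pi.one_apply]
  split_ifs <;> simp_all

variable {p}

lemma modelLaw_someRejected_pos (hp : ∀ j, 0 < p j) (hM : 0 < M) (hs : ∑ j, p j = 1)
    (h : ∀ i, confusionBound f p (α i) A j < 1 - p j) :
    0 < modelLaw M K p (someRejected f p α A j) := by
  have := isProbabilityMeasure_prior (fun j => (hp j).le) hs
  let i : Fin M := ⟨0, hM⟩
  have h1 : (modelLaw M K p) ((fun ω => ω i) ⁻¹' rejectSet f p (α i) A j)
      ≤ modelLaw M K p (someRejected f p α A j) := by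
    refine measure_mono fun ω hω => ?_
    simp only [someRejected, Set.mem_ofPred_eq, numRejected_eq]
    refine Finset.sum_pos' (fun k _ => Set.indicator_nonneg (fun _ _ => zero_le_one) _)
      ⟨i, Finset.mem_univ _, ?_⟩
    rw [Set.indicator_of_mem (show ω i ∈ rejectSet f p (α i) A j from hω)]
    exact one_pos
  refine lt_of_lt_of_le ?_ h1
  have h2 := (measurePreserving_eval (fun _ : Fin M => (prior p).prod
    (stdGaussian (EuclideanSpace ℝ (Fin K)))) i).measure_preimage
      (measurableSet_rejectSet f p (α i) A j).nullMeasurableSet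
  refine lt_of_lt_of_eq ?_ h2.symm
  exact (ENNReal.toReal_pos_iff.mp (rejectSet_real_pos f (α i) A j hp hs (h i))).1

lemma pFDR_le (hp : ∀ j, 0 < p j) (hf : Function.Injective f) (hM : 0 < M) (hs : ∑ j, p j = 1) {b : ℝ}
    (hb : ∀ i, confusionBound f p (α i) A j ≤ b) (hb1 : b < 1 - p j) :
    pFDR f p α A j ≤ b / (1 - p j) := by
  have := isProbabilityMeasure_prior (fun j => (hp j).le) hs
  have hpos := modelLaw_someRejected_pos f A j α hp hM hs fun i => (hb i).trans_lt hb1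
  have hprob : IsProbabilityMeasure (modelLaw M K p) := by unfold modelLaw; infer_instance
  have hpos' : 0 < (modelLaw M K p).real (someRejected f p α A j) :=
    ENNReal.toReal_pos hpos.ne' (measure_ne_top _ _)
  have h := integral_sum_div_sum_le ((prior p).prod (stdGaussian (EuclideanSpace ℝ (Fin K))))
    (G := fun i : Fin M => rejectSet f p (α i) A j)
    (H := fun i => rejectSet f p (α i) A j ∩ {z | z.1 = j})
    (fun i => measurableSet_rejectSet f p (α i) A j)
    (fun i => (measurableSet_rejectSet f p (α i) A j).inter
      (measurableSet_fst_eq j))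
    (fun i => Set.inter_subset_left)
    (fun i => rejectSet_inter_real_le_mul f (α i) A j hp hs (hb i) hb1)
  simp_rw [← numRejected_eq, ← numFalselyRejected_eq f p A j α hf] at h
  change ∫ ω, _ ∂(modelLaw M K p) ≤ _ * (modelLaw M K p).real (someRejected f p α A j) at h
  rw [pFDR, ProbabilityTheory.cond, integral_smul_measure,
    setIntegral_eq_integral_of_forall_compl_eq_zero, ENNReal.toReal_inv, smul_eq_mul,
    ← measureReal_def, inv_mul_le_iff₀ hpos', mul_comm]
  · exact h
  · intro ω hω
    have h0 : 0 ≤ numRejected f p α A j ω := by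
      rw [numRejected_eq]
      exact Finset.sum_nonneg fun k _ => Set.indicator_nonneg (fun _ _ => zero_le_one) _
    -- Without rejections the quotient is `0` by convention, so conditioning on `R > 0` only divides
    -- the full integral by the probability of that event.
    rw [le_antisymm (not_lt.mp hω) h0, div_zero]

end Rejection

end DSD

end

/-! ### Summation over pairs of classes and conclusion -/

namespace DSD

/-- The sum is `(∑ √(p j))² - 1 ≤ m - 1` by Cauchy–Schwarz, and `m * q ≤ 1`. -/
lemma sum_offDiag_sqrt_mul_le {m : ℕ} {p : Fin m → ℝ} (hp : ∀ j, 0 < p j) (hs : ∑ j, p j = 1)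
    {q : ℝ} (hq : 0 < q) (hqp : ∀ j, q ≤ p j) :
    ∑ x ∈ (Finset.univ : Finset (Fin m)).offDiag, √(p x.1 * p x.2) ≤ (1 - q) / q := by
  have h1 : (∑ j, √(p j)) ^ 2 ≤ m := by
    have h := sq_sum_le_card_mul_sum_sq (s := Finset.univ) (f := fun j => √(p j))
    simp_rw [Real.sq_sqrt (hp _).le, hs] at h
    simpa using h
  have h2 : (∑ j, √(p j)) ^ 2 = 1 + ∑ x ∈ (Finset.univ : Finset (Fin m)).offDiag,
      √(p x.1 * p x.2) := by
    rw [sq, Finset.sum_mul_sum, ← Finset.sum_product', ← Finset.diag_union_offDiag,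
      Finset.sum_union (Finset.disjoint_diag_offDiag _), Finset.sum_diag]
    congr 1
    · simp_rw [Real.mul_self_sqrt (hp _).le, hs]
    · exact Finset.sum_congr rfl fun x _ => (Real.sqrt_mul (hp _).le _).symm
  have h3 : m * q ≤ 1 := by
    have h := Finset.card_nsmul_le_sum Finset.univ p q fun j _ => hqp j
    rw [hs] at h
    simpa using h
  rw [le_div_iff₀ hq]
  nlinarith

/-- The right side depends neither on the class nor on the location, so a single `A` controls all of
them. -/
lemma confusionBound_le_sum {m K N : ℕ} (f : Fin m → EuclideanSpace ℝ (Fin N)) (p : Fin m → ℝ)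
    (A : Matrix (Fin K) (Fin N) ℝ) (j : Fin m) {a a₀ : ℝ} (ha₀ : 0 ≤ a₀) (ha : a₀ ≤ a) :
    confusionBound f p a A j ≤ ∑ x ∈ (Finset.univ : Finset (Fin m)).offDiag,
      √(p x.1 * p x.2) *
        Real.exp (-(a₀ ^ 2 / 8 * ‖Matrix.toEuclideanLin A (f x.1 - f x.2)‖ ^ 2)) := by
  calc confusionBound f p a A j ≤ ∑ l ∈ Finset.univ.erase j, √(p j * p l) *
          Real.exp (-(a₀ ^ 2 / 8 * ‖Matrix.toEuclideanLin A (f j - f l)‖ ^ 2)) := by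
        refine Finset.sum_le_sum fun l _ => ?_
        gcongr
    _ = ∑ x ∈ (Finset.univ.erase j).image (Prod.mk j), √(p x.1 * p x.2) *
          Real.exp (-(a₀ ^ 2 / 8 * ‖Matrix.toEuclideanLin A (f x.1 - f x.2)‖ ^ 2)) :=
        by rw [Finset.sum_image (Prod.mk_right_injective j).injOn]
    _ ≤ _ := by
        refine Finset.sum_le_sum_of_subset_of_nonneg ?_ fun x _ _ => by positivity
        intro x hx
        obtain ⟨l, hl, rfl⟩ := Finset.mem_image.mp hx
        simpa [eq_comm] using hl

lemma spectralNorm_le {K N : ℕ} {A : Matrix (Fin K) (Fin N) ℝ} {c : ℝ} (hc : 0 ≤ c)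
    (hA : ∀ x, ‖Matrix.toEuclideanLin A x‖ ≤ c * ‖x‖) : spectralNorm A ≤ c :=
  ContinuousLinearMap.opNorm_le_bound _ hc hA

lemma spectralNorm_pos {K N : ℕ} {A : Matrix (Fin K) (Fin N) ℝ}
    (hA : Matrix.toEuclideanLin A ≠ 0) : 0 < spectralNorm A :=
  norm_pos_iff.mpr fun h => hA (LinearMap.toContinuousLinearMap.map_eq_zero_iff.mp h)

lemma dMin_le {m N : ℕ} (f : Fin m → EuclideanSpace ℝ (Fin N)) {i j : Fin m} (h : i ≠ j) :
    dMin f ≤ ‖f i - f j‖ :=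
  ciInf_le (f := fun q : {q : Fin m × Fin m // q.1 ≠ q.2} => ‖f q.1.1 - f q.1.2‖)
    ⟨0, by rintro _ ⟨q, rfl⟩; exact norm_nonneg _⟩ ⟨(i, j), h⟩

end DSD

theorem theorem3 {m M K N : ℕ} (hM : 0 < M) (hK : 0 < K)
    -- dictionary of unit-norm targets, positive prior probabilities
    (f : Fin m → EuclideanSpace ℝ (Fin N)) (hf : ∀ j, ‖f j‖ = 1)
    (p : Fin m → ℝ) (hp_pos : ∀ j, 0 < p j) (hp_sum : ∑ j, p j = 1)
    -- signal strengths, sensor noise level, background covariance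
    (α : Fin M → ℝ) (hα : ∀ i, 0 ≤ α i) (σ : ℝ) (hσ : 0 < σ)
    (Sb : Matrix (Fin N) (Fin N) ℝ) (hSb : Sb.PosSemidef)
    (pmin pmax αmin dmin lamMax : ℝ)
    (hpmin : pmin = ⨅ j, p j) (hpmax : pmax = ⨆ j, p j) (hαmin : αmin = ⨅ i, α i)
    (hdmin : dmin = DSD.dMin f) (hlamMax : lamMax = DSD.largestEigenvalue hSb.isHermitian)
    (ε : ℝ) (hε_pos : 0 < ε) (hε_lt : ε < 1 - pmax)
    (h_pos : 1 - pmax - ε ≥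
      (1 - pmin) / pmin * (1 + αmin ^ 2 * dmin ^ 2 / (4 * K * σ ^ 2)) ^ (-(K : ℝ) / 2)
        + 2 * Real.exp (-((K + N) * ε ^ 2) / 2))
    (h_bg : lamMax < 1 / ((1 + ε) ^ 2 * (Real.sqrt ((N : ℝ) / K) + 1) ^ 2))
    (h_K : (K : ℝ) > 2 * Real.log (2 / pmin * ((1 - pmin) / (1 - pmax)))
      / Real.log (1 + αmin ^ 2 * dmin ^ 2 / (4 * K))) :
    ∃ A : Matrix (Fin K) (Fin N) ℝ,
      DSD.IsWhitenedSensing Sb σ A ∧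
      lamMax < 1 / DSD.spectralNorm A ^ 2 ∧
      (∀ j, 0 < DSD.modelLaw M K p (DSD.someRejected f p α A j)) ∧
      DSD.pFDRMax f p α A ≤
        1 / pmin * ((1 - pmax) / (1 - pmin) *
            (1 + αmin ^ 2 * dmin ^ 2 / (4 * K)) ^ ((K : ℝ) / 2) - 1 / pmin)⁻¹
          + 2 * (1 - pmax) / ε ^ 2 * Real.exp (-((K + N) * ε ^ 2) / 2) := by
  have hK' : (0 : ℝ) < K := by exact_mod_cast hK
  have hne : Nonempty (Fin m) := by
    by_contra h
    rw [not_nonempty_iff] at h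
    simp at hp_sum
  have hpmin_le : ∀ j, pmin ≤ p j := fun j =>
    hpmin ▸ ciInf_le (Set.finite_range p).bddBelow j
  have hpmax_ge : ∀ j, p j ≤ pmax := fun j =>
    hpmax ▸ le_ciSup (Set.finite_range p).bddAbove j
  have hpmin_pos : 0 < pmin := by
    obtain ⟨j, hj⟩ := exists_eq_ciInf_of_finite (f := p)
    rw [hpmin, ← hj]
    exact hp_pos j
  obtain ⟨j₀⟩ := id hne
  have hminmax : pmin ≤ pmax := (hpmin_le j₀).trans (hpmax_ge j₀)
  have hN : 0 < N := by
    rcases Nat.eq_zero_or_pos N with rfl | h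
    · have h1 := hf j₀
      rw [Subsingleton.elim (f j₀) 0, norm_zero] at h1
      exact absurd h1 zero_ne_one
    · exact h
  have hαmin0 : 0 ≤ αmin := hαmin ▸ Real.iInf_nonneg hα
  have hαmin_le : ∀ i, αmin ≤ α i := fun i => hαmin ▸ ciInf_le (Set.finite_range α).bddBelow i
  have hdmin0 : 0 ≤ dmin := hdmin ▸ Real.iInf_nonneg fun _ => norm_nonneg _
  -- Otherwise the power in `h_pos` would be `1`, giving `1 - pmax - ε > (1 - pmin) / pmin ≥ 1 -
  -- pmin`, against `pmin ≤ pmax`.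
  have hprod : αmin ^ 2 * dmin ^ 2 ≠ 0 := by
    intro h0
    rw [h0, zero_div, add_zero, Real.one_rpow, mul_one] at h_pos
    have h1 : 1 - pmin ≤ (1 - pmin) / pmin := by
      rw [le_div_iff₀ hpmin_pos]
      nlinarith
    have := Real.exp_pos (-((K + N) * ε ^ 2) / 2)
    linarith
  have hdmin_pos : 0 < dmin := hdmin0.lt_of_ne fun h => hprod (by rw [← h]; ring)
  have hinj : Function.Injective f := by
    intro i j hij
    by_contra h
    have := DSD.dMin_le f h
    rw [hij, sub_self, norm_zero, ← hdmin] at this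
    linarith
  set x := αmin ^ 2 * dmin ^ 2 / (4 * K) with hx
  have hx_pos : 0 < x := by
    have : 0 < αmin ^ 2 * dmin ^ 2 := lt_of_le_of_ne (by positivity) (Ne.symm hprod)
    positivity
  set X := (1 + x) ^ ((K : ℝ) / 2) with hX
  have hX_pos : 0 < X := by positivity
  have h1max : 0 < 1 - pmax := by linarith
  have h1min : 0 < 1 - pmin := by linarith
  -- This is `h_K` exponentiated; it amounts to `r > 2` below, hence `b = (1 - pmax) / r < 1 -
  -- pmax`.
  have hXgt : 2 / pmin * ((1 - pmin) / (1 - pmax)) < X := by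
    have hlog : 0 < Real.log (1 + x) := Real.log_pos (by linarith)
    rw [gt_iff_lt, div_lt_iff₀ hlog] at h_K
    rw [← Real.log_lt_log_iff (by positivity) hX_pos, hX, Real.log_rpow (by positivity)]
    linarith
  set r := pmin * ((1 - pmax) / (1 - pmin) * X) with hr
  have hr2 : 2 < r := by
    have h : pmin * ((1 - pmax) / (1 - pmin) * (2 / pmin * ((1 - pmin) / (1 - pmax)))) = 2 := by
      field_simp
    rw [← h, hr]
    gcongr
  obtain ⟨T, hT0, hTc, hTs⟩ := DSD.exists_linearMap_sum_exp_le hK hN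
    (Finset.univ : Finset (Fin m)).offDiag (fun y => √(p y.1 * p y.2))
    (fun _ => Real.sqrt_nonneg _) (fun y => f y.1 - f y.2) hdmin_pos
    (fun y hy => hdmin ▸ DSD.dMin_le f (Finset.mem_offDiag.mp hy).2.2)
    -- The Bhattacharyya exponent `τ = αmin² / 8` makes `2 τ dmin² / K` equal to `x`.
    (show 0 ≤ αmin ^ 2 / 8 by positivity)
  set A : Matrix (Fin K) (Fin N) ℝ := Matrix.toEuclideanLin.symm T with hA
  have hAT : Matrix.toEuclideanLin A = T := LinearEquiv.apply_symm_apply _ _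
  set b := (1 - pmin) / pmin * X⁻¹ with hb
  have hbr : b = (1 - pmax) / r := by
    rw [hb, hr]
    field_simp
  have hconf : ∀ i j, DSD.confusionBound f p (α i) A j ≤ b := by
    intro i j
    refine (DSD.confusionBound_le_sum f p A j hαmin0 (hαmin_le i)).trans ?_
    rw [hAT]
    refine hTs.trans ?_
    have h1 : (1 + 2 * (αmin ^ 2 / 8 * dmin ^ 2) / K) ^ (-(K : ℝ) / 2) = X⁻¹ := by
      rw [hX, ← Real.rpow_neg (by positivity), hx]
      congr 1
      · ring
      · ring
    rw [h1]
    exact mul_le_mul_of_nonneg_right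
      (DSD.sum_offDiag_sqrt_mul_le hp_pos hp_sum hpmin_pos hpmin_le) (by positivity)
  have hb_pos : 0 < b := by positivity
  have hb_lt : b < 1 - pmax := by
    rw [hbr, div_lt_iff₀ (by linarith)]
    nlinarith
  have hb_lt' : ∀ j, b < 1 - p j := fun j => by linarith [hpmax_ge j]
  set c := √((N : ℝ) / K) + 1 with hc
  have hc_pos : 0 < c := by positivity
  have hAc : ∀ y, ‖Matrix.toEuclideanLin A y‖ ≤ c * ‖y‖ := fun y => by rw [hAT]; exact hTc y
  have hlam : lamMax < 1 / c ^ 2 := by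
    refine h_bg.trans_le (one_div_le_one_div_of_le (by positivity) ?_)
    nlinarith [sq_nonneg c, sq_nonneg ε, mul_pos hε_pos (pow_pos hc_pos 2)]
  have hnorm := DSD.spectralNorm_le hc_pos.le hAc
  have hnorm0 : 0 < DSD.spectralNorm A := DSD.spectralNorm_pos (hAT ▸ hT0)
  refine ⟨A, ?_, ?_, fun j => ?_, ?_⟩
  · refine DSD.isWhitenedSensing_of_posDef hσ
      (DSD.posDef_one_sub_mul_mul_transpose hSb hc_pos.le hAc ?_)
    rw [← hlamMax]
    rwa [lt_div_iff₀ (by positivity)] at hlam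
  · exact hlam.trans_le (one_div_le_one_div_of_le (by positivity) (by gcongr))
  · exact DSD.modelLaw_someRejected_pos f A j α hp_pos hM hp_sum
      fun i => (hconf i j).trans_lt (hb_lt' j)
  · have h1 : DSD.pFDRMax f p α A ≤ b / (1 - pmax) := by
      refine ciSup_le fun j => ?_
      refine (DSD.pFDR_le f A j α hp_pos hinj hM hp_sum (fun i => hconf i j) (hb_lt' j)).trans ?_
      exact div_le_div_of_nonneg_left hb_pos.le h1max (by linarith [hpmax_ge j])
    have h2 : b / (1 - pmax) = 1 / r := by
      rw [hbr]
      field_simp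
    -- The first term of the claimed bound is `1 / (r - 1)`, slightly weaker than the `1 / r`
    -- obtained.
    have h3 : 1 / pmin * ((1 - pmax) / (1 - pmin) * X - 1 / pmin)⁻¹ = 1 / (r - 1) := by
      rw [hr, one_div_mul_eq_div, one_div, div_eq_mul_inv, mul_comm, ← mul_inv, mul_sub,
        mul_inv_cancel₀ hpmin_pos.ne', one_div]
    have h4 : 1 / r ≤ 1 / (r - 1) := one_div_le_one_div_of_le (by linarith) (by linarith)
    have h5 : 0 ≤ 2 * (1 - pmax) / ε ^ 2 * Real.exp (-((K + N) * ε ^ 2) / 2) := by positivity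
    rw [h3]
    linarith
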